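/- Let $p$ be an odd prime, let $m,k$ be positive integers, and put $e=\gcd(m,k)$, $s=m/e$ and $q=p^e$. Assume that $s$ is odd, $s\ge 3$, and $k/e$ is odd. Let $\lambda$ be a nonsquare in ${\rm GF}(q)\subseteq{\rm GF}(p^m)$, let $\zeta_p\in\mathbb C$ be a primitive $p$-th root of unity, and let ${\rm Tr}$ denote the trace from ${\rm GF}(p^m)$ to ${\rm GF}(p)$. For $a,b\in{\rm GF}(p^m)$ define $$T(a,b)=\sum_{y\in{\rm GF}(p)^*}\ \sum_{x\in{\rm GF}(p^m)}\left(\zeta_p^{{\rm Tr}(yax^2+ybx^{p^k+1})}+\zeta_p^{{\rm Tr}(-ya\lambda x^2-yb\lambda x^{p^k+1})}\right).$$ Then, as $(a,b)$ runs through ${\rm GF}(p^m)^2$, the sum $T(a,b)$ takes only the following values, with the following frequencies: - $2(p-1)p^m$, exactly once; - $2(p-1)p^{(m+e)/2}$, exactly $\frac12\left(p^{m-e}+p^{(m-e)/2}\right)(p^m-1)$ times; - $-2(p-1)p^{(m+e)/2}$, exactly $\frac12\left(p^{m-e}-p^{(m-e)/2}\right)(p^m-1)$ times; - $0$, exactly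 $(p^m-p^{m-e}+1)(p^m-1)$ times. -/

import Mathlib

namespace CyclicSums

/-- For a finite field `F` of characteristic `p`, a complex `p`-th root of unity `ζ` and `u : F`,
the value `ζ ^ Tr(u)`, where `Tr` is the absolute trace from `F` to `GF(p)`; an element of `GF(p)`
is represented by its residue in `{0, …, p - 1}`. -/
noncomputable def traceChar (p : ℕ) (F : Type*) [Field F] [Algebra (ZMod p) F]
    (ζ : ℂ) (u : F) : ℂ :=
  ζ ^ (Algebra.trace (ZMod p) F u).val

/-- The exponential sum
`T(a,b) = ∑_{y ∈ GF(p)^*} ∑_{x ∈ F}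
  (ζ ^ Tr(y a x² + y b x^(p^k+1)) + ζ ^ Tr(-y a lam x² - y b lam x^(p^k+1)))`. -/
noncomputable def T (p : ℕ) [Fact p.Prime] (F : Type*) [Field F] [Fintype F] [Algebra (ZMod p) F]
    (ζ : ℂ) (k : ℕ) (lam : F) (a b : F) : ℂ :=
  ∑ y : (ZMod p)ˣ, ∑ x : F,
    (traceChar p F ζ
        (algebraMap (ZMod p) F y * a * x ^ 2 + algebraMap (ZMod p) F y * b * x ^ (p ^ k + 1)) +
      traceChar p F ζ
        (-(algebraMap (ZMod p) F y * a * lam * x ^ 2) -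
          algebraMap (ZMod p) F y * b * lam * x ^ (p ^ k + 1)))

end CyclicSums

/-! With `K = GF(q)`, `[F : K] = s = 2t + 1` and `σ x = x ^ p ^ k`, the sum `T(a,b)` collects, over
the `2(p-1)` scalars `c = y, -λy`, the exponential sums of `c · Q`, where `Q x = Tr (a x² + b x σ
x)` is a quadratic form over `K`. Diagonalising `Q` shows that `c` enters only through `η(c) ^ r`,
with `η` the quadratic character and `r` the rank (`exists_sum_addChar_quadraticForm`). Since `λ` is
a nonsquare, the `η(c)` sum to zero, so odd rank gives `0`. For `(a,b) ≠ 0` the radical has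
dimension at most 2 (`card_radical_le`); as `s` is odd, even rank forces dimension 1 and the value
`±2(p-1) q ^ (t+1)` (`familySum_mem`). The frequencies then follow from the first two moments over
all `(a,b)`, computed by orthogonality (`sum_familySum`, `sum_familySum_sq`), and the total count.
-/

open Finset

namespace CyclicSums

/-! ### Quadratic Gauss sums and exponential sums of quadratic forms. -/

section QuadraticGaussSum

variable {K : Type*} [Field K] [Fintype K] [DecidableEq K]

/-- The quadratic character of a finite field with complex values. -/
noncomputable def quadChar (K : Type*) [Field K] [Fintype K] [DecidableEq K] : MulChar K ℂ :=
  (quadraticChar K).ringHomComp (Int.castRingHom ℂ)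

theorem quadChar_apply (a : K) : quadChar K a = (quadraticChar K a : ℂ) := rfl

theorem quadChar_eq_one_or_neg_one {a : K} (ha : a ≠ 0) :
    quadChar K a = 1 ∨ quadChar K a = -1 := by
  rcases quadraticChar_dichotomy ha with h | h <;> simp [quadChar_apply, h]

theorem quadChar_sq {a : K} (ha : a ≠ 0) : quadChar K a ^ 2 = 1 := by
  rcases quadChar_eq_one_or_neg_one ha with h | h <;> simp [h]

theorem quadChar_pow_of_even {a : K} (ha : a ≠ 0) {r : ℕ} (hr : Even r) :
    quadChar K a ^ r = 1 := by
  obtain ⟨t, rfl⟩ := hr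
  rw [← two_mul, pow_mul, quadChar_sq ha, one_pow]

theorem quadChar_pow_of_odd {a : K} (ha : a ≠ 0) {r : ℕ} (hr : Odd r) :
    quadChar K a ^ r = quadChar K a := by
  obtain ⟨t, rfl⟩ := hr
  rw [pow_succ, pow_mul, quadChar_sq ha, one_pow, one_mul]

theorem quadChar_ne_one (hK : ringChar K ≠ 2) : quadChar K ≠ 1 :=
  (MulChar.ringHomComp_ne_one_iff (RingHom.injective_int _)).mpr (quadraticChar_ne_one hK)

theorem gaussSum_quadChar_sq (hK : ringChar K ≠ 2) {ψ : AddChar K ℂ} (hψ : ψ.IsPrimitive) :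
    gaussSum (quadChar K) ψ ^ 2 = quadChar K (-1) * Fintype.card K :=
  gaussSum_sq (quadChar_ne_one hK) ((quadraticChar_isQuadratic K).comp _) hψ

theorem card_sq_eq (hK : ringChar K ≠ 2) (u : K) :
    ((#{t : K | t ^ 2 = u} : ℕ) : ℂ) = quadChar K u + 1 := by
  have h := quadraticChar_card_sqrts hK u
  have h' : ((#{t : K | t ^ 2 = u} : ℕ) : ℤ) = quadraticChar K u + 1 := by
    rw [← h]; congr 2; ext; simp
  rw [quadChar_apply]
  exact_mod_cast h'

/-- Grouping by `u = t²` weights `ψ (w u)` by `η(u) + 1`; the constant part vanishes by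
orthogonality and the rest is a shifted Gauss sum. -/
theorem sum_addChar_mul_sq (hK : ringChar K ≠ 2) {ψ : AddChar K ℂ} (hψ : ψ.IsPrimitive)
    {w : K} (hw : w ≠ 0) :
    ∑ t : K, ψ (w * t ^ 2) = quadChar K w * gaussSum (quadChar K) ψ := by
  have h1 : ∑ t : K, ψ (w * t ^ 2) = ∑ u : K, (quadChar K u + 1) * ψ (w * u) := by
    rw [← sum_fiberwise univ (fun t : K => t ^ 2) (fun t => ψ (w * t ^ 2))]
    refine sum_congr rfl fun u _ => ?_
    rw [← card_sq_eq hK, ← nsmul_eq_mul, ← sum_const]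
    exact sum_congr rfl fun t ht => by rw [(mem_filter.1 ht).2]
  have h2 : ∑ u : K, ψ (w * u) = 0 := by
    have := AddChar.sum_mulShift w hψ
    simpa [hw, mul_comm] using this
  have h3 := gaussSum_mulShift (quadChar K) ψ (Units.mk0 w hw)
  rw [h1]
  simp only [add_mul, one_mul, sum_add_distrib, h2, add_zero]
  rw [← h3, Units.val_mk0, ← mul_assoc, ← sq, quadChar_sq hw, one_mul]
  rfl

theorem sum_addChar_weightedSumSquares (hK : ringChar K ≠ 2) {ψ : AddChar K ℂ}
    (hψ : ψ.IsPrimitive) {ι : Type*} [Fintype ι] [DecidableEq ι] (w : ι → K) {c : K}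
    (hc : c ≠ 0) :
    ∑ v : ι → K, ψ (c * QuadraticMap.weightedSumSquares K w v) =
      quadChar K c ^ #{i | w i ≠ 0} * (∏ i with w i ≠ 0, quadChar K (w i)) *
        gaussSum (quadChar K) ψ ^ #{i | w i ≠ 0} * (Fintype.card K : ℂ) ^ #{i | w i = 0} := by
  have h1 (v : ι → K) : ψ (c * QuadraticMap.weightedSumSquares K w v) =
      ∏ i, ψ (c * w i * v i ^ 2) := by
    rw [QuadraticMap.weightedSumSquares_apply]
    have h := map_prod ψ.toMonoidHom (fun i => Multiplicative.ofAdd (c * w i * v i ^ 2)) univ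
    rw [← ofAdd_sum] at h
    refine Eq.trans (congrArg ψ ?_) h
    rw [mul_sum]
    exact sum_congr rfl fun i _ => by simp [sq, mul_assoc]
  simp_rw [h1]
  rw [← Fintype.prod_sum (fun i t => ψ (c * w i * t ^ 2)),
    ← prod_filter_mul_prod_filter_not univ (fun i => w i ≠ 0)]
  congr 1
  · rw [← prod_const, ← prod_const, ← prod_mul_distrib, ← prod_mul_distrib]
    refine prod_congr rfl fun i hi => ?_
    rw [sum_addChar_mul_sq hK hψ (mul_ne_zero hc (mem_filter.1 hi).2), map_mul]
  · simp only [not_not]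
    rw [← prod_const]
    refine prod_congr rfl fun i hi => ?_
    simp [(mem_filter.1 hi).2]

/-- In diagonal coordinates the sum factors into one-variable sums. Here `d` counts the zero
weights, and only a lower bound for the radical is needed, since it turns an upper bound on the
radical into one on `d`. -/
theorem exists_sum_addChar_quadraticForm (hK : ringChar K ≠ 2) {ψ : AddChar K ℂ}
    (hψ : ψ.IsPrimitive) {V : Type*} [AddCommGroup V] [Module K V] [Fintype V]
    (Q : QuadraticForm K V) :
    ∃ (r d : ℕ) (ε : ℂ), r + d = Module.finrank K V ∧
      Fintype.card K ^ d ≤ Nat.card {x : V // ∀ y, Q (x + y) = Q y} ∧ (ε = 1 ∨ ε = -1) ∧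
      ∀ c : K, c ≠ 0 → ∑ x : V, ψ (c * Q x) =
        quadChar K c ^ r * ε * gaussSum (quadChar K) ψ ^ r * (Fintype.card K : ℂ) ^ d := by
  have : Invertible (2 : K) := invertibleOfNonzero (Ring.two_ne_zero hK)
  obtain ⟨w, ⟨f⟩⟩ := Q.equivalent_weightedSumSquares
  refine ⟨#{i | w i ≠ 0}, #{i | w i = 0}, ∏ i with w i ≠ 0, quadChar K (w i), ?_, ?_, ?_, ?_⟩
  · have := card_filter_add_card_filter_not (s := univ) (fun i => w i ≠ 0)
    simpa using this
  · have hcard : Fintype.card K ^ #{i | w i = 0} = Nat.card ({i // w i = 0} → K) := by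
      rw [Nat.card_eq_fintype_card, Fintype.card_fun, Fintype.card_subtype]
    rw [hcard]
    -- Extension by zero embeds the coordinates of weight zero; its image consists of radical
    -- vectors.
    let g : ({i // w i = 0} → K) → (Fin (Module.finrank K V) → K) :=
      fun u i => if h : w i = 0 then u ⟨i, h⟩ else 0
    have hg (u) (i) : w i = 0 ∨ g u i = 0 := by
      by_cases h : w i = 0
      · exact Or.inl h
      · exact Or.inr (by simp [g, h])
    refine Nat.card_le_card_of_injective
      (fun u => ⟨f.symm (g u), fun y => ?_⟩) fun u u' h => ?_
    · rw [← f.map_app, ← f.map_app y]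
      have : f (f.symm (g u) + y) = g u + f y := by
        rw [map_add]; congr 1; exact f.toLinearEquiv.apply_symm_apply _
      rw [this]
      simp only [QuadraticMap.weightedSumSquares_apply, Pi.add_apply]
      refine sum_congr rfl fun i _ => ?_
      rcases hg u i with h | h <;> simp [h]
    · have h1 : g u = g u' := f.symm.toLinearEquiv.injective (congrArg Subtype.val h)
      funext ⟨i, hi⟩
      have := congrFun h1 i
      simpa [g, hi] using this
  · refine prod_induction _ (fun z : ℂ => z = 1 ∨ z = -1) ?_ (Or.inl rfl) fun i hi =>
      quadChar_eq_one_or_neg_one (mem_filter.1 hi).2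
    rintro a b (rfl | rfl) (rfl | rfl) <;> simp
  · intro c hc
    rw [← sum_addChar_weightedSumSquares hK hψ w hc, ← f.toLinearEquiv.toEquiv.sum_comp]
    refine sum_congr rfl fun x _ => ?_
    congr 2
    exact (f.map_app x).symm

end QuadraticGaussSum

/-! ### Solution counts for `σ`-difference equations. -/

section SemilinearEquations

variable {K F : Type*} [Field K] [Fintype K] [Field F] [Fintype F] [DecidableEq F] [Algebra K F]

theorem card_fixed_le {σ : F ≃ₐ[K] F} (hσ : ∀ x, σ x = x → x ∈ Set.range (algebraMap K F)) :
    #{x : F | σ x = x} ≤ Fintype.card K := by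
  calc #{x : F | σ x = x} ≤ #(univ.image (algebraMap K F)) := by
        refine card_le_card fun x hx => ?_
        obtain ⟨t, ht⟩ := hσ x (mem_filter.1 hx).2
        exact mem_image.2 ⟨t, mem_univ _, ht⟩
    _ ≤ Fintype.card K := card_image_le

/-- Differences of solutions solve the homogeneous equation, and the quotient of two such
differences is fixed by `σ`, hence lies in `K`. -/
theorem card_first_order_le {σ : F ≃ₐ[K] F}
    (hσ : ∀ x, σ x = x → x ∈ Set.range (algebraMap K F)) (κ β : F) :
    #{x : F | σ x = κ * x + β} ≤ Fintype.card K := by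
  by_cases h : ∃ v₀ v₁ : F, v₀ ≠ v₁ ∧ σ v₀ = κ * v₀ + β ∧ σ v₁ = κ * v₁ + β
  · obtain ⟨v₀, v₁, hne, h₀, h₁⟩ := h
    have hd : v₁ - v₀ ≠ 0 := sub_ne_zero.2 hne.symm
    have hσd : σ (v₁ - v₀) = κ * (v₁ - v₀) := by rw [map_sub, h₀, h₁]; ring
    have hκ : κ ≠ 0 := by
      rintro rfl
      rw [zero_mul, EmbeddingLike.map_eq_zero_iff] at hσd
      exact hd hσd
    refine le_trans (card_le_card_of_injOn (fun x => (x - v₀) / (v₁ - v₀)) ?_ ?_)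
      (card_fixed_le hσ)
    · intro x hx
      have hx : σ x = κ * x + β := by simpa using hx
      simp only [coe_filter, mem_univ, true_and, Set.mem_ofPred_eq]
      rw [map_div₀, hσd, map_sub, hx, h₀]
      field_simp
      ring
    · intro x _ y _ hxy
      have := (div_left_inj' hd).1 hxy
      exact sub_left_injective this
  · push Not at h
    refine le_trans (card_le_one.2 fun x hx y hy => ?_) Fintype.card_pos
    by_contra hxy
    exact h x y hxy (mem_filter.1 hx).2 (mem_filter.1 hy).2

/-- Reduction of order: for a nonzero solution `x₁`, the quantity `σ (x / x₁) - x / x₁` satisfies a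
first-order homogeneous equation, and each of its values determines `x` up to at most `|K|` choices.
-/
theorem card_second_order_le {σ : F ≃ₐ[K] F}
    (hσ : ∀ x, σ x = x → x ∈ Set.range (algebraMap K F)) {A : F} (hA : A ≠ 0) (B C : F) :
    #{x : F | A * σ (σ x) + B * σ x + C * x = 0} ≤ Fintype.card K ^ 2 := by
  set S : Finset F := {x : F | A * σ (σ x) + B * σ x + C * x = 0} with hS
  by_cases h : ∃ x₁ ∈ S, x₁ ≠ 0
  · obtain ⟨x₁, hx₁, h0⟩ := h
    have hx₁ : A * σ (σ x₁) + B * σ x₁ + C * x₁ = 0 := (mem_filter.1 hx₁).2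
    have hσ0 : σ x₁ ≠ 0 := by simpa using h0
    have hσσ0 : σ (σ x₁) ≠ 0 := by simpa using h0
    set φ : F → F := fun x => σ (x / x₁) - x / x₁ with hφ
    have hfib : #S ≤ Fintype.card K * #(S.image φ) := by
      refine card_le_mul_card_image S _ fun w _ => ?_
      refine le_trans (card_le_card_of_injOn (fun x => x / x₁) ?_ ?_)
        (card_first_order_le hσ 1 w)
      · intro x hx
        have hx : φ x = w := (mem_filter.1 hx).2
        simp only [coe_filter, mem_univ, true_and, Set.mem_ofPred_eq]
        rw [← hx]; ring
      · intro x _ y _ hxy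
        exact (div_left_inj' h0).1 hxy
    have himg : #(S.image φ) ≤ Fintype.card K := by
      refine le_trans (card_le_card fun v hv => ?_)
        (card_first_order_le hσ (-(A * σ (σ x₁) + B * σ x₁) / (A * σ (σ x₁))) 0)
      obtain ⟨x, hx, rfl⟩ := mem_image.1 hv
      have hx : A * σ (σ x) + B * σ x + C * x = 0 := (mem_filter.1 hx).2
      simp only [mem_filter, mem_univ, true_and, hφ, map_sub, map_div₀]
      field_simp
      linear_combination x₁ * σ x₁ * hx - σ x₁ * x * hx₁
    calc #S ≤ Fintype.card K * #(S.image φ) := hfib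
      _ ≤ Fintype.card K * Fintype.card K := Nat.mul_le_mul_left _ himg
      _ = _ := (sq _).symm
  · push Not at h
    refine le_trans (card_le_one.2 fun x hx y hy => ?_) (Nat.pow_pos Fintype.card_pos)
    rw [h x hx, h y hy]

end SemilinearEquations

/-! ### The radical of the trace form. -/

section TraceForms

variable {K F : Type*} [Field K] [Field F] [Algebra K F]

/-- The quadratic form `x ↦ Tr (a x² + b x σ(x))`. -/
noncomputable def twistedTraceForm (σ : F ≃ₐ[K] F) (a b : F) : QuadraticForm K F :=
  LinearMap.BilinMap.toQuadraticMap (LinearMap.mk₂ K (fun x y => Algebra.trace K F (a * x * y + b * x * σ y))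
    (fun x x' y => by rw [← map_add]; congr 1; ring)
    (fun c x y => by
      rw [← map_smul]; congr 1; simp only [Algebra.smul_def]; ring)
    (fun x y y' => by
      rw [← map_add (Algebra.trace K F)]; congr 1; rw [map_add]; ring)
    (fun c x y => by
      rw [← map_smul (Algebra.trace K F)]; congr 1; rw [map_smul]; simp only [Algebra.smul_def]; ring))

theorem twistedTraceForm_apply (σ : F ≃ₐ[K] F) (a b x : F) :
    twistedTraceForm σ a b x = Algebra.trace K F (a * x ^ 2 + b * (σ x * x)) := by
  have : twistedTraceForm σ a b x = Algebra.trace K F (a * x * x + b * x * σ x) := rfl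
  rw [this]; congr 1; ring

variable [Fintype K] [Fintype F]

/-- Invariance of the trace under `σ` writes the polar form as `Tr (L(x) y)`, with `L(x)` the left
side below; nondegeneracy of the trace form gives `L(x) = 0`. -/
theorem eq_zero_of_mem_radical {σ : F ≃ₐ[K] F} {a b x : F}
    (hx : ∀ y, twistedTraceForm σ a b (x + y) = twistedTraceForm σ a b y) :
    2 * a * x + b * σ x + σ.symm (b * x) = 0 := by
  have h0 : twistedTraceForm σ a b x = 0 := by
    have := hx 0
    rwa [add_zero, map_zero] at this
  refine (traceForm_nondegenerate K F).1 _ fun y => ?_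
  rw [Algebra.traceForm_apply]
  have h1 := hx y
  have h2 : Algebra.trace K F (σ.symm (b * x) * y) = Algebra.trace K F (b * x * σ y) := by
    rw [← Algebra.trace_eq_of_algEquiv σ, map_mul, σ.apply_symm_apply]
  rw [add_mul, map_add, h2, ← map_add]
  rw [twistedTraceForm_apply] at h0 h1
  rw [twistedTraceForm_apply] at h1
  have h3 : (2 * a * x + b * σ x) * y + b * x * σ y =
      (a * (x + y) ^ 2 + b * (σ (x + y) * (x + y))) - (a * x ^ 2 + b * (σ x * x))
        - (a * y ^ 2 + b * (σ y * y)) := by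
    rw [map_add]; ring
  rw [h3, map_sub, map_sub, h0, h1, sub_zero, sub_self]

theorem card_radical_le {σ : F ≃ₐ[K] F}
    (hσ : ∀ x, σ x = x → x ∈ Set.range (algebraMap K F)) (h2 : (2 : F) ≠ 0) {a b : F}
    (hab : (a, b) ≠ 0) :
    Nat.card {x : F // ∀ y, twistedTraceForm σ a b (x + y) = twistedTraceForm σ a b y} ≤
      Fintype.card K ^ 2 := by
  classical
  rw [Nat.card_eq_fintype_card, Fintype.card_subtype]
  by_cases hb : b = 0
  · subst hb
    have ha : a ≠ 0 := by rintro rfl; exact hab rfl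
    have hz (x : F) (hx : ∀ y, twistedTraceForm σ a 0 (x + y) = twistedTraceForm σ a 0 y) :
        x = 0 := by
      simpa [h2, ha] using eq_zero_of_mem_radical hx
    refine le_trans (card_le_one.2 fun x hx y hy => ?_) (Nat.pow_pos Fintype.card_pos)
    rw [hz x (mem_filter.1 hx).2, hz y (mem_filter.1 hy).2]
  -- Applying `σ` removes `σ.symm` and leaves a second-order equation with leading coefficient `σ b
  -- ≠ 0`.
  · refine le_trans (card_le_card fun x hx => ?_)
      (card_second_order_le hσ (A := σ b) (by simpa using hb) (σ (2 * a)) b)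
    have := congrArg σ (eq_zero_of_mem_radical (mem_filter.1 hx).2)
    rw [map_add, map_add, σ.apply_symm_apply, map_zero, map_mul, map_mul σ b] at this
    simp only [mem_filter, mem_univ, true_and]
    linear_combination this

end TraceForms

/-! ### First and second moments of the sums. -/

section Moments

variable {K F : Type*} [Field K] [Field F] [Fintype F] [Algebra K F]

/-- The sum over a family of scalars `c` of the exponential sums of the forms
`c i * (a x² + b x σ(x))`. -/
noncomputable def familySum (χ : AddChar F ℂ) (σ : F ≃ₐ[K] F) {ι : Type*} [Fintype ι]
    (c : ι → K) (ab : F × F) : ℂ :=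
  ∑ i, ∑ x : F, χ (algebraMap K F (c i) * (ab.1 * x ^ 2 + ab.2 * (σ x * x)))

theorem sum_pair_addChar [DecidableEq F] {χ : AddChar F ℂ} (hχ : χ.IsPrimitive) (u v : F) :
    ∑ ab : F × F, χ (ab.1 * u + ab.2 * v) =
      if u = 0 ∧ v = 0 then (Fintype.card F : ℂ) ^ 2 else 0 := by
  simp_rw [AddChar.map_add_eq_mul]
  rw [Fintype.sum_prod_type]
  dsimp only
  rw [← sum_mul_sum, AddChar.sum_mulShift _ hχ, AddChar.sum_mulShift _ hχ]
  by_cases hu : u = 0 <;> by_cases hv : v = 0 <;> simp [hu, hv, sq]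

theorem familySum_zero (χ : AddChar F ℂ) (σ : F ≃ₐ[K] F) {ι : Type*} [Fintype ι] (c : ι → K) :
    familySum χ σ c 0 = Fintype.card ι * Fintype.card F := by
  simp [familySum]

theorem sum_familySum {χ : AddChar F ℂ} (hχ : χ.IsPrimitive) (σ : F ≃ₐ[K] F) {ι : Type*}
    [Fintype ι] {c : ι → K} (hc : ∀ i, c i ≠ 0) :
    ∑ ab : F × F, familySum χ σ c ab = Fintype.card ι * (Fintype.card F : ℂ) ^ 2 := by
  classical
  have h (i : ι) (x : F) : ∑ ab : F × F,
      χ (algebraMap K F (c i) * (ab.1 * x ^ 2 + ab.2 * (σ x * x))) =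
        if x = 0 then (Fintype.card F : ℂ) ^ 2 else 0 := by
    have := sum_pair_addChar hχ (algebraMap K F (c i) * x ^ 2)
      (algebraMap K F (c i) * (σ x * x))
    have h0 : (algebraMap K F (c i) * x ^ 2 = 0 ∧ algebraMap K F (c i) * (σ x * x) = 0) ↔
        x = 0 := by
      have := hc i
      simp [this]
    rw [if_congr h0 rfl rfl] at this
    rw [← this]
    exact sum_congr rfl fun ab _ => by congr 1; ring
  unfold familySum
  rw [sum_comm]
  simp_rw [sum_comm (s := (univ : Finset (F × F))), h]
  simp

/-- The two equations force `σ x / x = σ z / z`, so `x = t z` with `t` in `K`, and the system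
reduces to `t² = -c' / c`. -/
theorem card_pair_zeros [Fintype K] [DecidableEq K] [DecidableEq F] (hK : ringChar K ≠ 2) {σ : F ≃ₐ[K] F}
    (hσ : ∀ x, σ x = x → x ∈ Set.range (algebraMap K F)) {c c' : K} (hc : c ≠ 0) (hc' : c' ≠ 0)
    {z : F} (hz : z ≠ 0) :
    ((#{x : F | algebraMap K F c * x ^ 2 + algebraMap K F c' * z ^ 2 = 0 ∧
      algebraMap K F c * (σ x * x) + algebraMap K F c' * (σ z * z) = 0} : ℕ) : ℂ) =
        quadChar K (-1) * quadChar K c * quadChar K c' + 1 := by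
  have hq : quadChar K (-1) * quadChar K c * quadChar K c' = quadChar K (-c' / c) := by
    have h1 : -1 * c * c' = (-c' / c) * c ^ 2 := by field_simp
    rw [← map_mul, ← map_mul, h1, map_mul, map_pow, quadChar_sq hc, mul_one]
  rw [hq, ← card_sq_eq hK]
  congr 1
  have hcF : algebraMap K F c ≠ 0 := by simpa using hc
  have hc'F : algebraMap K F c' ≠ 0 := by simpa using hc'
  have hσz : σ z ≠ 0 := by simpa using hz
  symm
  refine card_bij (fun t _ => algebraMap K F t * z) ?_ ?_ ?_
  · intro t ht
    have ht : t ^ 2 = -c' / c := (mem_filter.1 ht).2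
    have ht' : c * t ^ 2 = -c' := by rw [ht]; field_simp
    have ht'' : algebraMap K F c * algebraMap K F t ^ 2 = -algebraMap K F c' := by
      rw [← map_pow, ← map_mul, ht', map_neg]
    simp only [mem_filter, mem_univ, true_and, map_mul, AlgEquiv.commutes]
    constructor
    · linear_combination z ^ 2 * ht''
    · linear_combination σ z * z * ht''
  · intro t _ t' _ h
    exact (algebraMap K F).injective (mul_right_cancel₀ hz h)
  · intro x hx
    obtain ⟨h1, h2⟩ := (mem_filter.1 hx).2
    have hx0 : x ≠ 0 := by
      rintro rfl
      simp [hz, hc'] at h1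
    have hfix : σ (x / z) = x / z := by
      rw [map_div₀]
      field_simp
      refine mul_left_cancel₀ (mul_ne_zero (mul_ne_zero hcF hz) hx0) ?_
      linear_combination z ^ 2 * h2 - z * σ z * h1
    obtain ⟨t, ht⟩ := hσ _ hfix
    refine ⟨t, ?_, by rw [ht]; field_simp⟩
    simp only [mem_filter, mem_univ, true_and]
    apply (algebraMap K F).injective
    rw [map_pow, ht, map_div₀, map_neg]
    field_simp
    linear_combination h1

/-- Orthogonality reduces each pair of scalars to the zero count above; the terms with `η(c i) η(c
j)` cancel on summing because the `η(c i)` sum to zero. -/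
theorem sum_familySum_sq [Fintype K] [DecidableEq K] (hK : ringChar K ≠ 2) {χ : AddChar F ℂ}
    (hχ : χ.IsPrimitive) {σ : F ≃ₐ[K] F}
    (hσ : ∀ x, σ x = x → x ∈ Set.range (algebraMap K F)) {ι : Type*}
    [Fintype ι] {c : ι → K} (hc : ∀ i, c i ≠ 0) (hsum : ∑ i, quadChar K (c i) = 0) :
    ∑ ab : F × F, familySum χ σ c ab ^ 2 =
      (Fintype.card ι : ℂ) ^ 2 * (Fintype.card F : ℂ) ^ 3 := by
  classical
  have hpair (i j : ι) : ∑ ab : F × F, ∑ z : F, ∑ x : F,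
      χ (algebraMap K F (c i) * (ab.1 * x ^ 2 + ab.2 * (σ x * x))) *
      χ (algebraMap K F (c j) * (ab.1 * z ^ 2 + ab.2 * (σ z * z))) =
      (Fintype.card F : ℂ) ^ 2 * (Fintype.card F +
        (Fintype.card F - 1) * quadChar K (-1) * quadChar K (c i) * quadChar K (c j)) := by
    have h1 (x z : F) : ∑ ab : F × F,
        χ (algebraMap K F (c i) * (ab.1 * x ^ 2 + ab.2 * (σ x * x))) *
        χ (algebraMap K F (c j) * (ab.1 * z ^ 2 + ab.2 * (σ z * z))) =
        if algebraMap K F (c i) * x ^ 2 + algebraMap K F (c j) * z ^ 2 = 0 ∧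
          algebraMap K F (c i) * (σ x * x) + algebraMap K F (c j) * (σ z * z) = 0
        then (Fintype.card F : ℂ) ^ 2 else 0 := by
      rw [← sum_pair_addChar hχ]
      refine sum_congr rfl fun ab _ => ?_
      rw [← AddChar.map_add_eq_mul]
      congr 1; ring
    have h2 (z : F) : ∑ ab : F × F, ∑ x : F,
        χ (algebraMap K F (c i) * (ab.1 * x ^ 2 + ab.2 * (σ x * x))) *
        χ (algebraMap K F (c j) * (ab.1 * z ^ 2 + ab.2 * (σ z * z))) =
        (Fintype.card F : ℂ) ^ 2 * if z = 0 then 1 else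
          quadChar K (-1) * quadChar K (c i) * quadChar K (c j) + 1 := by
      rw [sum_comm]
      simp_rw [h1]
      rw [← sum_filter, sum_const, nsmul_eq_mul, mul_comm]
      congr 1
      split_ifs with hz
      · subst hz
        have : ({x : F | algebraMap K F (c i) * x ^ 2 + algebraMap K F (c j) * 0 ^ 2 = 0 ∧
          algebraMap K F (c i) * (σ x * x) + algebraMap K F (c j) * (σ 0 * 0) = 0} : Finset F)
            = {0} := by
          ext x
          simp [hc i]
        rw [this]; simp
      · exact card_pair_zeros hK hσ (hc i) (hc j) hz
    rw [sum_comm]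
    simp_rw [h2]
    rw [← mul_sum]
    congr 1
    rw [Fintype.sum_eq_add_sum_compl (0 : F), if_pos rfl,
      sum_congr rfl fun z hz => if_neg (by simpa using hz), sum_const, nsmul_eq_mul, card_compl,
      card_singleton, Nat.cast_sub Fintype.card_pos]
    push_cast
    ring
  have hexp (ab : F × F) : familySum χ σ c ab ^ 2 = ∑ i, ∑ j, ∑ z : F, ∑ x : F,
      χ (algebraMap K F (c i) * (ab.1 * x ^ 2 + ab.2 * (σ x * x))) *
      χ (algebraMap K F (c j) * (ab.1 * z ^ 2 + ab.2 * (σ z * z))) := by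
    unfold familySum
    rw [sq, sum_mul_sum]
    refine sum_congr rfl fun i _ => sum_congr rfl fun j _ => ?_
    rw [sum_mul_sum, sum_comm]
  simp_rw [hexp]
  rw [sum_comm]
  simp_rw [sum_comm (s := (univ : Finset (F × F))) (t := (univ : Finset ι)), hpair]
  simp_rw [← mul_sum, sum_add_distrib, ← mul_sum, hsum]
  simp
  ring

end Moments

/-! ### Moments in terms of multiplicities. -/

section Counting

variable {α : Type*} [Fintype α] {f : α → ℂ} {v₀ v₁ : ℂ}

theorem value_multiplicities (hf : ∀ x, f x ∈ ({v₀, v₁, -v₁, 0} : Set ℂ)) (h₀ : v₀ ≠ 0)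
    (h₁ : v₁ ≠ 0) (h₀₁ : v₀ ≠ v₁) (h₀₁' : v₀ ≠ -v₁) :
    ∑ x, f x = v₀ * {x | f x = v₀}.ncard + v₁ * ({x | f x = v₁}.ncard - {x | f x = -v₁}.ncard) ∧
    ∑ x, f x ^ 2 =
      v₀ ^ 2 * {x | f x = v₀}.ncard + v₁ ^ 2 * ({x | f x = v₁}.ncard + {x | f x = -v₁}.ncard) ∧
    (Fintype.card α : ℂ) = {x | f x = v₀}.ncard + {x | f x = v₁}.ncard + {x | f x = -v₁}.ncard +
      {x | f x = 0}.ncard := by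
  classical
  have hn (v : ℂ) : ({x | f x = v}.ncard : ℂ) = ∑ x, if f x = v then 1 else 0 := by
    rw [← sum_filter, sum_const, nsmul_one, ← Set.ncard_coe_finset]
    congr 2
    ext; simp
  have h₁' : v₁ ≠ -v₁ := fun h => h₁ (self_eq_neg.1 h)
  refine ⟨?_, ?_, ?_⟩
  · simp_rw [hn]
    rw [← sum_sub_distrib, mul_sum, mul_sum, ← sum_add_distrib]
    refine sum_congr rfl fun x _ => ?_
    rcases hf x with h | h | h | h <;> rw [h] <;>
      simp [h₁, h₀₁, h₀₁', h₁', h₀.symm, h₁.symm, h₀₁.symm, h₀₁'.symm, h₁'.symm]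
  · simp_rw [hn]
    rw [← sum_add_distrib, mul_sum, mul_sum, ← sum_add_distrib]
    refine sum_congr rfl fun x _ => ?_
    rcases hf x with h | h | h | h <;> rw [h] <;>
      simp [h₁, h₀₁, h₀₁', h₁', h₀.symm, h₁.symm, h₀₁.symm, h₀₁'.symm, h₁'.symm]
  · simp_rw [hn]
    rw [← sum_add_distrib, ← sum_add_distrib, ← sum_add_distrib, ← nsmul_one, Fintype.card,
      ← sum_const]
    refine sum_congr rfl fun x _ => ?_
    rcases hf x with h | h | h | h <;> rw [h] <;>
      simp [h₀, h₁, h₀₁, h₀₁', h₁', h₀.symm, h₁.symm, h₀₁.symm, h₀₁'.symm, h₁'.symm]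

end Counting

/-! ### Values and their frequencies. -/

section Distribution

variable {K F : Type*} [Field K] [Fintype K] [DecidableEq K] [Field F] [Fintype F] [Algebra K F]

theorem familySum_mem (hK : ringChar K ≠ 2) {ψ : AddChar K ℂ} (hψ : ψ.IsPrimitive)
    {χ : AddChar F ℂ} (hχψ : ∀ u, χ u = ψ (Algebra.trace K F u)) {σ : F ≃ₐ[K] F}
    (hσ : ∀ x, σ x = x → x ∈ Set.range (algebraMap K F)) {t : ℕ}
    (ht : Module.finrank K F = 2 * t + 1) {ι : Type*} [Fintype ι] {c : ι → K}
    (hc : ∀ i, c i ≠ 0) (hsum : ∑ i, quadChar K (c i) = 0) {ab : F × F} (hab : ab ≠ 0) :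
    familySum χ σ c ab ∈ ({(Fintype.card ι : ℂ) * Fintype.card K ^ (t + 1),
      -((Fintype.card ι : ℂ) * Fintype.card K ^ (t + 1)), 0} : Set ℂ) := by
  have h2 : (2 : F) ≠ 0 := by
    have : (2 : K) ≠ 0 := Ring.two_ne_zero hK
    rw [← map_ofNat (algebraMap K F)]
    simpa using this
  obtain ⟨r, d, ε, hrd, hd, hε, hval⟩ :=
    exists_sum_addChar_quadraticForm hK hψ (twistedTraceForm σ ab.1 ab.2)
  have hd2 : d ≤ 2 :=
    (Nat.pow_le_pow_iff_right Fintype.one_lt_card).1 (hd.trans (card_radical_le hσ h2 hab))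
  have hfam : familySum χ σ c ab = ∑ i, quadChar K (c i) ^ r * ε * gaussSum (quadChar K) ψ ^ r *
      (Fintype.card K : ℂ) ^ d := by
    refine sum_congr rfl fun i _ => ?_
    rw [← hval _ (hc i)]
    refine sum_congr rfl fun x _ => ?_
    rw [hχψ, twistedTraceForm_apply, ← Algebra.smul_def, map_smul, smul_eq_mul]
  rcases Nat.even_or_odd r with hr | hr
  -- `r + d = 2t + 1` with `r` even makes `d` odd, and `d ≤ 2`.
  · have hd1 : d = 1 := by
      obtain ⟨u, hu⟩ := hr
      omega
    have hrt : r = 2 * t := by omega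
    have hG : gaussSum (quadChar K) ψ ^ r = quadChar K (-1) ^ t * (Fintype.card K : ℂ) ^ t := by
      rw [hrt, pow_mul, gaussSum_quadChar_sq hK hψ, mul_pow]
    have hone : quadChar K (-1) ^ t = 1 ∨ quadChar K (-1) ^ t = -1 := by
      rcases quadChar_eq_one_or_neg_one (neg_ne_zero.2 (one_ne_zero (α := K))) with h | h
      · simp [h]
      · rw [h]; exact neg_one_pow_eq_or ℂ t
    have hfam' : familySum χ σ c ab = ε * quadChar K (-1) ^ t *
        ((Fintype.card ι : ℂ) * Fintype.card K ^ (t + 1)) := by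
      rw [hfam, hd1, hG]
      simp_rw [quadChar_pow_of_even (hc _) hr]
      rw [sum_const, card_univ, nsmul_eq_mul]
      ring
    rw [hfam']
    rcases hε with rfl | rfl <;> rcases hone with h | h <;> rw [h] <;> simp
  · rw [hfam, ← sum_mul, ← sum_mul, ← sum_mul]
    simp_rw [quadChar_pow_of_odd (hc _) hr]
    simp [hsum]

theorem familySum_distribution (hK : ringChar K ≠ 2) {ψ : AddChar K ℂ} (hψ : ψ.IsPrimitive)
    {χ : AddChar F ℂ} (hχ : χ.IsPrimitive) (hχψ : ∀ u, χ u = ψ (Algebra.trace K F u))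
    {σ : F ≃ₐ[K] F} (hσ : ∀ x, σ x = x → x ∈ Set.range (algebraMap K F)) {t : ℕ} (ht0 : 0 < t)
    (ht : Module.finrank K F = 2 * t + 1) {ι : Type*} [Fintype ι] [Nonempty ι] {c : ι → K}
    (hc : ∀ i, c i ≠ 0) (hsum : ∑ i, quadChar K (c i) = 0) {v₀ v₁ : ℂ} {q : ℕ}
    (hq : Fintype.card K = q) (hv₀ : v₀ = (Fintype.card ι : ℂ) * q ^ (2 * t + 1))
    (hv₁ : v₁ = (Fintype.card ι : ℂ) * q ^ (t + 1)) :
    (∀ ab, familySum χ σ c ab ∈ ({v₀, v₁, -v₁, 0} : Set ℂ)) ∧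
    {ab | familySum χ σ c ab = v₀}.ncard = 1 ∧
    ({ab | familySum χ σ c ab = v₁}.ncard : ℚ) =
      1 / 2 * ((q : ℚ) ^ (2 * t) + (q : ℚ) ^ t) * ((q : ℚ) ^ (2 * t + 1) - 1) ∧
    ({ab | familySum χ σ c ab = -v₁}.ncard : ℚ) =
      1 / 2 * ((q : ℚ) ^ (2 * t) - (q : ℚ) ^ t) * ((q : ℚ) ^ (2 * t + 1) - 1) ∧
    ({ab | familySum χ σ c ab = 0}.ncard : ℚ) =
      ((q : ℚ) ^ (2 * t + 1) - (q : ℚ) ^ (2 * t) + 1) * ((q : ℚ) ^ (2 * t + 1) - 1) := by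
  have hq1 : 1 < q := hq ▸ Fintype.one_lt_card
  have hF : Fintype.card F = q ^ (2 * t + 1) := by rw [Module.card_eq_pow_finrank (K := K), hq, ht]
  have hqC : (q : ℂ) ≠ 0 := by
    have : q ≠ 0 := by omega
    exact_mod_cast this
  have hιC : (Fintype.card ι : ℂ) ≠ 0 := by exact_mod_cast Fintype.card_ne_zero
  have hv₀0 : v₀ ≠ 0 := by rw [hv₀]; positivity
  have hv₁0 : v₁ ≠ 0 := by rw [hv₁]; positivity
  -- The exponents `2t + 1` and `t + 1` differ because `t > 0`.
  have hv₀₁ : v₀ ≠ v₁ := by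
    rw [hv₀, hv₁]
    intro h
    have h := mul_left_cancel₀ hιC h
    have h : q ^ (2 * t + 1) = q ^ (t + 1) := by exact_mod_cast h
    have := Nat.pow_right_injective hq1 h
    omega
  have hv₀₁' : v₀ ≠ -v₁ := by
    rw [hv₀, hv₁, ← mul_neg]
    intro h
    have h := eq_neg_iff_add_eq_zero.1 (mul_left_cancel₀ hιC h)
    have h : q ^ (2 * t + 1) + q ^ (t + 1) = 0 := by exact_mod_cast h
    have : 0 < q ^ (t + 1) := by positivity
    omega
  have hzero : familySum χ σ c 0 = v₀ := by
    rw [familySum_zero, hv₀, hF]; push_cast; rfl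
  have hnz {ab : F × F} (hab : ab ≠ 0) : familySum χ σ c ab ∈ ({v₁, -v₁, 0} : Set ℂ) := by
    have := familySum_mem hK hψ hχψ hσ ht hc hsum hab
    rwa [hq, ← hv₁] at this
  have hmem (ab : F × F) : familySum χ σ c ab ∈ ({v₀, v₁, -v₁, 0} : Set ℂ) := by
    by_cases hab : ab = 0
    · rw [hab, hzero]; exact Or.inl rfl
    · exact Or.inr (hnz hab)
  have hone : {ab | familySum χ σ c ab = v₀}.ncard = 1 := by
    rw [Set.ncard_eq_one]
    refine ⟨0, Set.ext fun ab => ⟨fun h => ?_, fun h => ?_⟩⟩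
    · by_contra hab
      have h : familySum χ σ c ab = v₀ := h
      rcases hnz hab with h' | h' | h'
      · exact hv₀₁ (h.symm.trans h')
      · exact hv₀₁' (h.symm.trans h')
      · exact hv₀0 (h.symm.trans h')
    · rw [Set.mem_singleton_iff.1 h]; exact hzero
  obtain ⟨e₁, e₂, e₃⟩ := value_multiplicities hmem hv₀0 hv₁0 hv₀₁ hv₀₁'
  rw [sum_familySum hχ σ hc, hone, hF] at e₁
  rw [sum_familySum_sq hK hχ hσ hc hsum, hone, hF] at e₂
  rw [hone, Fintype.card_prod, hF] at e₃
  refine ⟨hmem, hone, ?_⟩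
  generalize {ab | familySum χ σ c ab = v₁}.ncard = n₁ at *
  generalize {ab | familySum χ σ c ab = -v₁}.ncard = n₂ at *
  generalize {ab | familySum χ σ c ab = 0}.ncard = n₃ at *
  push_cast at e₁ e₂ e₃
  -- The first moment gives `n₁ - n₂` and the second `n₁ + n₂`, once the contribution of `(0,0)` is
  -- removed.
  have d₁ : (n₁ : ℂ) - n₂ = q ^ t * (q ^ (2 * t + 1) - 1) := by
    refine mul_left_cancel₀ hv₁0 ?_
    rw [hv₀] at e₁
    rw [hv₁] at e₁ ⊢
    linear_combination -e₁
  have d₂ : (n₁ : ℂ) + n₂ = q ^ (2 * t) * (q ^ (2 * t + 1) - 1) := by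
    refine mul_left_cancel₀ (pow_ne_zero 2 hv₁0) ?_
    rw [hv₀] at e₂
    rw [hv₁] at e₂ ⊢
    linear_combination -e₂
  refine ⟨?_, ?_, ?_⟩ <;> apply Rat.cast_injective (α := ℂ) <;> push_cast
  · linear_combination (d₁ + d₂) / 2
  · linear_combination (d₂ - d₁) / 2
  · linear_combination -e₃ - d₂

end Distribution

/-! ### The Frobenius power `σ` and its fixed field. -/

section FrobeniusPowers

/-- A fixed point of `σ` has periods `k` and `m` under `y ↦ y ^ p`, hence period `gcd m k`; it is
then fixed by the Frobenius over `K`, which generates the Galois group. -/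
theorem exists_frobenius_power {p m k : ℕ} [Fact p.Prime]
    {K F : Type*} [Field K] [Fintype K] [Field F] [Fintype F] [Algebra K F]
    (hK : Fintype.card K = p ^ Nat.gcd m k) (hF : Fintype.card F = p ^ m) :
    ∃ σ : F ≃ₐ[K] F, (∀ x, σ x = x ^ p ^ k) ∧
      ∀ x, σ x = x → x ∈ Set.range (algebraMap K F) := by
  obtain ⟨l, hl⟩ := Nat.gcd_dvd_right m k
  have happ (x : F) : (FiniteField.frobeniusAlgEquivOfAlgebraic K F ^ l) x = x ^ p ^ k := by
    rw [AlgEquiv.coe_pow, FiniteField.coe_frobeniusAlgEquivOfAlgebraic_iterate, hK, ← pow_mul,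
      ← hl]
  refine ⟨FiniteField.frobeniusAlgEquivOfAlgebraic K F ^ l, happ, fun x hx => ?_⟩
  rw [happ] at hx
  have hit (n : ℕ) : (fun y : F => y ^ p)^[n] = fun y => y ^ p ^ n := pow_iterate p n
  have h1 : Function.IsPeriodicPt (fun y : F => y ^ p) k x := by
    rw [Function.IsPeriodicPt, hit]; exact hx
  have h2 : Function.IsPeriodicPt (fun y : F => y ^ p) m x := by
    rw [Function.IsPeriodicPt, hit]
    exact hF ▸ FiniteField.pow_card x
  have h3 : x ^ p ^ Nat.gcd m k = x := by
    have := h2.gcd h1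
    rwa [Function.IsPeriodicPt, hit] at this
  have h4 : FiniteField.frobeniusAlgEquivOfAlgebraic K F x = x := by
    rw [FiniteField.coe_frobeniusAlgEquivOfAlgebraic, hK]; exact h3
  rw [IsGalois.mem_range_algebraMap_iff_fixed]
  intro f
  obtain ⟨n, rfl⟩ := (FiniteField.bijective_frobeniusAlgEquivOfAlgebraic_pow K F).2 f
  rw [AlgEquiv.coe_pow]
  exact Function.iterate_fixed h4 _

end FrobeniusPowers

/-! ### Trace characters and the scalars `y`, `-λy`. -/

section TraceCharacters

variable {p : ℕ} [Fact p.Prime] {ζ : ℂ}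

/-- `traceChar` as an additive character. -/
noncomputable def traceAddChar (hζ : IsPrimitiveRoot ζ p) (F : Type*) [Field F]
    [Algebra (ZMod p) F] : AddChar F ℂ :=
  (AddChar.zmodChar p hζ.pow_eq_one).compAddMonoidHom (Algebra.trace (ZMod p) F).toAddMonoidHom

theorem traceAddChar_apply (hζ : IsPrimitiveRoot ζ p) (F : Type*) [Field F]
    [Algebra (ZMod p) F] (u : F) : traceAddChar hζ F u = traceChar p F ζ u := rfl

theorem traceAddChar_isPrimitive (hζ : IsPrimitiveRoot ζ p) (F : Type*) [Field F] [Finite F]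
    [Algebra (ZMod p) F] : (traceAddChar hζ F).IsPrimitive := by
  refine AddChar.IsPrimitive.of_ne_one (AddChar.ne_one_iff.2 ?_)
  obtain ⟨u, hu⟩ := Algebra.trace_surjective (ZMod p) F 1
  refine ⟨u, fun h => ?_⟩
  have h' : AddChar.zmodChar p hζ.pow_eq_one (Algebra.trace (ZMod p) F u) = 1 := h
  rw [(AddChar.zmodChar_primitive_of_primitive_root p hζ).zmod_char_eq_one_iff, hu] at h'
  exact one_ne_zero h'

theorem traceAddChar_trace (hζ : IsPrimitiveRoot ζ p) (K F : Type*) [Field K] [Field F]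
    [Finite F] [Algebra (ZMod p) K] [Algebra (ZMod p) F] [Algebra K F] (u : F) :
    traceAddChar hζ F u = traceAddChar hζ K (Algebra.trace K F u) := by
  have : IsScalarTower (ZMod p) K F := IsScalarTower.of_algebraMap_eq' (Subsingleton.elim _ _)
  have : Finite K := Finite.of_injective _ (algebraMap K F).injective
  simp only [traceAddChar_apply, traceChar, Algebra.trace_trace]

/-- The scalars `y` and `-lam * y` with `y` in the prime field, nonzero. -/
def scalarFamily (p : ℕ) [Fact p.Prime] {K : Type*} [Field K] [Algebra (ZMod p) K]
    (lam : K) : (ZMod p)ˣ × Bool → K :=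
  fun i => cond i.2 (algebraMap (ZMod p) K i.1) (-lam * algebraMap (ZMod p) K i.1)

theorem scalarFamily_ne_zero {K : Type*} [Field K] [Algebra (ZMod p) K] {lam : K}
    (hlam : lam ≠ 0) (i : (ZMod p)ˣ × Bool) : scalarFamily p lam i ≠ 0 := by
  obtain ⟨y, _ | _⟩ := i <;> simp [scalarFamily, hlam]

/-- Since `η(λ) = -1`, the half with `-λy` is minus the sum of `η(-y)`, and `y ↦ -y` permutes the
units, so the halves cancel. -/
theorem sum_quadChar_scalarFamily (p : ℕ) [Fact p.Prime] {K : Type*} [Field K] [Fintype K] [DecidableEq K]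
    [Algebra (ZMod p) K] {lam : K} (hlam : ¬ IsSquare lam) :
    ∑ i : (ZMod p)ˣ × Bool, quadChar K (scalarFamily p lam i) = 0 := by
  have hl : quadChar K lam = -1 := by
    rw [quadChar_apply, quadraticChar_neg_one_iff_not_isSquare.2 hlam]; simp
  have h1 (y : (ZMod p)ˣ) : quadChar K (-lam * algebraMap (ZMod p) K y) =
      -quadChar K (-algebraMap (ZMod p) K y) := by
    rw [show -lam * algebraMap (ZMod p) K y = lam * -algebraMap (ZMod p) K y by ring, map_mul, hl,
      neg_one_mul]
  have h2 : ∑ y : (ZMod p)ˣ, quadChar K (-algebraMap (ZMod p) K y) =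
      ∑ y : (ZMod p)ˣ, quadChar K (algebraMap (ZMod p) K y) := by
    rw [← Equiv.sum_comp (Equiv.neg (ZMod p)ˣ) fun y => quadChar K (algebraMap (ZMod p) K y)]
    simp
  rw [Fintype.sum_prod_type]
  simp only [Fintype.sum_bool, scalarFamily, cond_true, cond_false, h1, sum_add_distrib,
    sum_neg_distrib, h2, add_neg_cancel]

theorem T_eq_familySum (hζ : IsPrimitiveRoot ζ p) {K F : Type*} [Field K] [Field F]
    [Fintype F] [Algebra (ZMod p) K] [Algebra (ZMod p) F] [Algebra K F] {σ : F ≃ₐ[K] F} {k : ℕ}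
    (hσ : ∀ x, σ x = x ^ p ^ k) (lam : K) (a b : F) :
    T p F ζ k (algebraMap K F lam) a b =
      familySum (traceAddChar hζ F) σ (scalarFamily p lam) (a, b) := by
  have htower (y : ZMod p) : algebraMap K F (algebraMap (ZMod p) K y) =
      algebraMap (ZMod p) F y :=
    RingHom.congr_fun (Subsingleton.elim ((algebraMap K F).comp (algebraMap (ZMod p) K)) _) y
  unfold T familySum
  rw [Fintype.sum_prod_type]
  refine sum_congr rfl fun y _ => ?_
  rw [sum_add_distrib, Fintype.sum_bool]
  congr 1 <;> refine sum_congr rfl fun x _ => ?_ <;>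
    rw [← traceAddChar_apply hζ] <;> congr 1 <;>
    simp only [scalarFamily, cond_true, cond_false, map_mul, map_neg, htower, hσ] <;> ring

end TraceCharacters

end CyclicSums

theorem theorem2 (p m k e : ℕ) [Fact p.Prime] (hp : p ≠ 2) (hm : 0 < m) (hk : 0 < k)
    (he : e = Nat.gcd m k) (hs : Odd (m / e)) (hs3 : 3 ≤ m / e) (hke : Odd (k / e))
    (K F : Type*) [Field K] [Fintype K] [Field F] [Fintype F] [Algebra K F] [Algebra (ZMod p) F]
    (hK : Fintype.card K = p ^ e) (hF : Fintype.card F = p ^ m)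
    (lam : K) (hlam : ¬ IsSquare lam) (ζ : ℂ) (hζ : IsPrimitiveRoot ζ p) :
    (∀ a b : F, CyclicSums.T p F ζ k (algebraMap K F lam) a b ∈
      ({2 * ((p : ℂ) - 1) * (p : ℂ) ^ m, 2 * ((p : ℂ) - 1) * (p : ℂ) ^ ((m + e) / 2),
        -(2 * ((p : ℂ) - 1) * (p : ℂ) ^ ((m + e) / 2)), 0} : Set ℂ)) ∧
    {ab : F × F | CyclicSums.T p F ζ k (algebraMap K F lam) ab.1 ab.2 =
      2 * ((p : ℂ) - 1) * (p : ℂ) ^ m}.ncard = 1 ∧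
    (({ab : F × F | CyclicSums.T p F ζ k (algebraMap K F lam) ab.1 ab.2 =
        2 * ((p : ℂ) - 1) * (p : ℂ) ^ ((m + e) / 2)}.ncard : ℕ) : ℚ) =
      1 / 2 * ((p : ℚ) ^ (m - e) + (p : ℚ) ^ ((m - e) / 2)) * ((p : ℚ) ^ m - 1) ∧
    (({ab : F × F | CyclicSums.T p F ζ k (algebraMap K F lam) ab.1 ab.2 =
        -(2 * ((p : ℂ) - 1) * (p : ℂ) ^ ((m + e) / 2))}.ncard : ℕ) : ℚ) =
      1 / 2 * ((p : ℚ) ^ (m - e) - (p : ℚ) ^ ((m - e) / 2)) * ((p : ℚ) ^ m - 1) ∧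
    (({ab : F × F | CyclicSums.T p F ζ k (algebraMap K F lam) ab.1 ab.2 = 0}.ncard : ℕ) : ℚ) =
      ((p : ℚ) ^ m - (p : ℚ) ^ (m - e) + 1) * ((p : ℚ) ^ m - 1) := by
  classical
  have hp' : p.Prime := Fact.out
  have he0 : 0 < e := he ▸ Nat.gcd_pos_of_pos_left k hm
  have hme : e * (m / e) = m := Nat.mul_div_cancel' (he ▸ Nat.gcd_dvd_left m k)
  obtain ⟨t, ht⟩ := hs
  have ht0 : 0 < t := by omega
  rw [ht] at hme
  have hFC : CharP F p := charP_of_injective_algebraMap (algebraMap (ZMod p) F).injective p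
  have hKC : CharP K p := (algebraMap K F).charP (algebraMap K F).injective p
  let _ : Algebra (ZMod p) K := ZMod.algebra K p
  have hK2 : ringChar K ≠ 2 := by rwa [ringChar.eq K p]
  have hrank : Module.finrank K F = 2 * t + 1 := by
    have h := Module.card_eq_pow_finrank (K := K) (V := F)
    rw [hF, hK, ← pow_mul, ← hme] at h
    exact (Nat.eq_of_mul_eq_mul_left he0 (Nat.pow_right_injective hp'.two_le h)).symm
  obtain ⟨σ, hσ, hfix⟩ := CyclicSums.exists_frobenius_power (he ▸ hK) hF
  have hlam0 : lam ≠ 0 := by rintro rfl; exact hlam IsSquare.zero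
  have hcard : (Fintype.card ((ZMod p)ˣ × Bool) : ℂ) = 2 * ((p : ℂ) - 1) := by
    rw [Fintype.card_prod, ZMod.card_units, Fintype.card_bool, Nat.cast_mul,
      Nat.cast_sub hp'.one_lt.le]
    push_cast; ring
  -- As `m = e (2t + 1)`, the divisions by 2 are exact and the subtraction does not truncate.
  have x1 : (m + e) / 2 = e * (t + 1) := by
    rw [← hme]
    exact Nat.div_eq_of_eq_mul_right two_pos (by ring)
  have x2 : m - e = e * (2 * t) := by rw [← hme]; exact Nat.sub_eq_of_eq_add (by ring)
  have x3 : (m - e) / 2 = e * t := by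
    rw [x2]; exact Nat.div_eq_of_eq_mul_right two_pos (by ring)
  have key := CyclicSums.familySum_distribution hK2
    (CyclicSums.traceAddChar_isPrimitive hζ K) (CyclicSums.traceAddChar_isPrimitive hζ F)
    (CyclicSums.traceAddChar_trace hζ K F) hfix ht0 hrank
    (CyclicSums.scalarFamily_ne_zero (p := p) hlam0)
    (CyclicSums.sum_quadChar_scalarFamily (p := p) hlam) hK rfl rfl
  rw [x3, x2, x1]
  simp only [CyclicSums.T_eq_familySum hζ hσ]
  rw [← hme]
  simp only [hcard, Nat.cast_pow, ← pow_mul] at key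
  exact ⟨fun a b => key.1 (a, b), key.2⟩
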